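/- Let $\Gamma=SL_2(\mathbb{Z})$, let $\Gamma_\infty\subset\Gamma$ be the subgroup generated by $\pm\begin{pmatrix}1&1\\0&1\end{pmatrix}$, and write $q=e^{2\pi i\tau}$ and $D=\frac{1}{2\pi i}\frac{d}{d\tau}$ for $\tau$ in the upper half-plane $\mathbb{H}$. For an even integer $k\ge 4$ and a one-periodic function $\phi:\mathbb{H}\to\mathbb{C}$ let $$\mathbb{P}_k(\phi;\tau)=\sum_{M\in\Gamma_\infty\backslash\Gamma}(\phi|_kM)(\tau),\qquad (\phi|_kM)(\tau)=(c\tau+d)^{-k}\phi\Big(\frac{a\tau+b}{c\tau+d}\Big),\quad M=\begin{pmatrix}a&b\\c&d\end{pmatrix},$$ whenever this converges absolutely, and let $P_{k,N}=\mathbb{P}_k(q^N)$. Let $E_2=1-24\sum_{n\ge1}\sigma_1(n)q^n$ and $E_4=1+240\sum_{n\ge1}\sigma_3(n)q^n$. For $n \ge 0$, the $n$-th order Serre derivative $\vartheta^{[n]}$ in weight $k$ is defined by $\vartheta^{[0]}f=f$, $\vartheta^{[1]}f=Df-\frac{k}{12}E_2f$ and $$\vartheta^{[n+1]}f=D\vartheta^{[n]}f-\frac{k+2n}{12}E_2\,\vartheta^{[n]}f-\frac{n(k+n-1)}{144}E_4\,\vartheta^{[n-1]}f\qquad(n\ge1).$$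 Theorem 4. Let $m,N\ge0$ be integers and let $l\ge4$ be an even integer with $l\ge2m+2$. Set $$\phi(\tau)=q^N\sum_{r=0}^m\binom{m}{r}\frac{(l+m-1)!}{(l+m-r-1)!}\Big(-\frac{E_2(\tau)}{12}\Big)^rN^{m-r}$$ (with $0^0=1$). Then the series $P_{l,N}$ converges absolutely and is a modular form of weight $l$ for $\Gamma$, the series $\mathbb{P}_{l+2m}(\phi)$ converges absolutely, and the $m$-th order Serre derivative of $P_{l,N}$ in weight $l$ is $$\vartheta^{[m]}P_{l,N}=\mathbb{P}_{l+2m}(\phi).$$ Moreover, $\phi$ is the result of formally applying $\vartheta^{[m]}$ in weight $l$ to the function $q^N$. -/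

import Mathlib

open UpperHalfPlane
open scoped MatrixGroups ModularForm Nat

noncomputable section

namespace Poincare

/-- The subgroup `Γ_∞` of `SL₂(ℤ)` generated by `± (1 1; 0 1)`. -/
def GammaInf : Subgroup SL(2, ℤ) :=
  Subgroup.closure {ModularGroup.T, -ModularGroup.T}

/-- The set of cosets `Γ_∞ \ SL₂(ℤ)`, that is, `M ~ M'` if and only if `M' M⁻¹ ∈ Γ_∞`. -/
abbrev Cosets : Type := Quotient (QuotientGroup.rightRel GammaInf)

/-- The summand `F |_k M` of the Poincaré series at a coset. It is computed at a representative;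
`cosetTerm_mk` shows that for even `k` and one-periodic `F` any representative gives the same. -/
def cosetTerm (k : ℤ) (F : ℍ → ℂ) (M : Cosets) : ℍ → ℂ :=
  F ∣[k] (Quotient.out M : SL(2, ℤ))

lemma slash_T (k : ℤ) (F : ℍ → ℂ) (hF : ∀ τ : ℍ, F ((1 : ℝ) +ᵥ τ) = F τ) :
    F ∣[k] ModularGroup.T = F := by
  ext τ
  rw [ModularForm.SL_slash_apply, UpperHalfPlane.modular_T_smul, hF]
  have h : denom (ModularGroup.T : GL (Fin 2) ℝ) τ = 1 := by
    rw [ModularGroup.denom_apply, ModularGroup.coe_T]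
    simp
  simp [h]

lemma slash_neg_T (k : ℤ) (hk : Even k) (F : ℍ → ℂ)
    (hF : ∀ τ : ℍ, F ((1 : ℝ) +ᵥ τ) = F τ) : F ∣[k] (-ModularGroup.T) = F := by
  ext τ
  rw [ModularForm.SL_slash_apply, ModularGroup.SL_neg_smul, UpperHalfPlane.modular_T_smul, hF]
  have h : denom ((-ModularGroup.T : SL(2, ℤ)) : GL (Fin 2) ℝ) τ = -1 := by
    rw [ModularGroup.denom_apply, Matrix.SpecialLinearGroup.coe_neg, ModularGroup.coe_T]
    simp
  rw [h, hk.neg.neg_one_zpow, mul_one]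

lemma cosetTerm_mk (k : ℤ) (hk : Even k) (F : ℍ → ℂ)
    (hF : ∀ τ : ℍ, F ((1 : ℝ) +ᵥ τ) = F τ) (M : SL(2, ℤ)) :
    cosetTerm k F (Quotient.mk _ M) = F ∣[k] M := by
  have inv : ∀ g ∈ GammaInf, F ∣[k] g = F := by
    intro g hg
    induction hg using Subgroup.closure_induction with
    | mem x hx =>
      rcases hx with rfl | hx
      · exact slash_T k F hF
      · rw [Set.mem_singleton_iff.mp hx]
        exact slash_neg_T k hk F hF
    | one => exact SlashAction.slash_one k F
    | mul x y _ _ hx hy => rw [SlashAction.slash_mul, hx, hy]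
    | inv x _ hx =>
      conv_lhs => rw [← hx]
      rw [← SlashAction.slash_mul, mul_inv_cancel, SlashAction.slash_one]
  have h : (QuotientGroup.rightRel GammaInf) (Quotient.out (Quotient.mk _ M)) M :=
    Quotient.mk_out (s := QuotientGroup.rightRel GammaInf) M
  rw [QuotientGroup.rightRel_apply] at h
  have h2 := inv _ h
  unfold cosetTerm
  conv_lhs => rw [← h2]
  rw [← SlashAction.slash_mul]
  simp

/-- Absolute convergence of the Poincaré series of `F` of weight `k` at every point. -/
def Converges (k : ℤ) (F : ℍ → ℂ) : Prop :=
  ∀ τ : ℍ, Summable fun M : Cosets ↦ ‖cosetTerm k F M τ‖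

/-- The Poincaré series `ℙ_k(F; τ) = ∑_{M ∈ Γ_∞ \ SL₂(ℤ)} (F |_k M)(τ)`. -/
def series (k : ℤ) (F : ℍ → ℂ) (τ : ℍ) : ℂ :=
  ∑' M : Cosets, cosetTerm k F M τ

/-- The function `q^N`, where `q = e^{2πiτ}`. -/
def qPow (N : ℕ) (τ : ℍ) : ℂ :=
  Complex.exp (2 * Real.pi * Complex.I * (τ : ℂ)) ^ N

/-- The Poincaré series of exponential type `P_{l,N} = ℙ_l(q^N)`. -/
def expSeries (l : ℤ) (N : ℕ) : ℍ → ℂ :=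
  series l (qPow N)

/-- The `n`-th order Serre derivative `ϑ^{[n]}` in weight `k`: `ϑ^{[0]} f = f`,
`ϑ^{[1]} f = D f - (k/12) E₂ f` and
`ϑ^{[n+1]} f = ϑ ϑ^{[n]} f - (n (k+n-1) / 144) E₄ ϑ^{[n-1]} f` for `n ≥ 1`,
where the outer `ϑ` is the Serre derivative in weight `k + 2n`. -/
def serreDeriv (k : ℕ) : ℕ → (ℍ → ℂ) → ℍ → ℂ
  | 0, f => f
  | 1, f => Derivative.serreDerivative (k : ℂ) f
  | n + 2, f => fun τ ↦
      Derivative.serreDerivative ((k : ℂ) + 2 * (n + 1)) (serreDeriv k (n + 1) f) τ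
        - ((n : ℂ) + 1) * ((k : ℂ) + (n + 1) - 1) / 144 * ModularForm.E₄ τ
          * serreDeriv k n f τ

/-- The seed function
`φ = q^N ∑_{r=0}^m C(m,r) ((l+m-1)! / (l+m-r-1)!) (-E₂/12)^r N^{m-r}`. -/
def seed (m N l : ℕ) (τ : ℍ) : ℂ :=
  qPow N τ * ∑ r ∈ Finset.range (m + 1),
    (m.choose r : ℂ) * (((l + m - 1)! : ℂ) / ((l + m - r - 1)! : ℂ))
      * (-EisensteinSeries.E2 τ / 12) ^ r * (N : ℂ) ^ (m - r)

end Poincare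

end

/-!
The higher Serre derivative `ϑ^{[m]}` in weight `l` intertwines the slash actions of weights `l` and
`l + 2m` (`serreDeriv_slash`): one step of its recursion is a Serre derivative, which is equivariant,
corrected by a multiple of the modular form `E₄`. Applied term by term to
`P_{l,N} = ∑ q^N ∣[l] M`, it therefore gives `∑ (ϑ^{[m]} q^N) ∣[l + 2m] M`. Two things remain.

* *Termwise application.* On vertical strips the series is dominated by an Eisenstein series of
  weight `l ≥ 4`, as `|q^N| ≤ 1`. This normal convergence survives multiplication by continuous
  functions and, by Cauchy's estimate, differentiation (`NormallySummable.serreDeriv`). So the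
  absolute convergence of `ℙ_{l+2m}(φ)` comes for free, and no growth estimate for `E₂` near the
  real line is needed.
* *The seed.* By Ramanujan's identity `D E₂ = (E₂² - E₄) / 12` (`deriv_E2`), proved here from the
  vanishing of the space of cusp forms of weight `4`, the function `X = -E₂ / 12` satisfies
  `D X = E₄ / 144 - X²`. With `ϑ^{[n]} q^N = q^N p_n(X)`, the `E₄` terms of the recursion cancel if
  `p_{n+1}' = (n + 1)(l + n) p_n`, and the rest reads
  `p_{n+1} = (N + (l + 2n) X) p_n - X² p_n'`; the explicit coefficients satisfy both
  (`derivative_seedPoly`, `seedPoly_succ`).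
-/

noncomputable section

open UpperHalfPlane Filter
open scoped MatrixGroups ModularForm Nat Topology Manifold Derivative

namespace Poincare

/-! ### Normally convergent series of functions on the upper half-plane -/

/-- A family `f i` of functions on `ℍ` is normally summable if every point has a neighbourhood on
which the family is dominated by a summable family of constants. -/
def NormallySummable {ι : Type*} (f : ι → ℍ → ℂ) : Prop :=
  ∀ z : ℍ, ∃ s ∈ 𝓝 z, ∃ u : ι → ℝ, Summable u ∧ ∀ i, ∀ w ∈ s, ‖f i w‖ ≤ u i

namespace NormallySummable

variable {ι : Type*} {f g : ι → ℍ → ℂ}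

lemma summable_norm (hf : NormallySummable f) (z : ℍ) : Summable fun i ↦ ‖f i z‖ := by
  obtain ⟨s, hs, u, hu, h⟩ := hf z
  exact hu.of_nonneg_of_le (fun _ ↦ norm_nonneg _) fun i ↦ h i z (mem_of_mem_nhds hs)

lemma summable (hf : NormallySummable f) (z : ℍ) : Summable fun i ↦ f i z :=
  (hf.summable_norm z).of_norm

lemma sub (hf : NormallySummable f) (hg : NormallySummable g) :
    NormallySummable fun i z ↦ f i z - g i z := by
  intro z
  obtain ⟨s, hs, u, hu, h⟩ := hf z
  obtain ⟨t, ht, v, hv, h'⟩ := hg z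
  exact ⟨s ∩ t, inter_mem hs ht, fun i ↦ u i + v i, hu.add hv, fun i w hw ↦
    (norm_sub_le _ _).trans (add_le_add (h i w hw.1) (h' i w hw.2))⟩

lemma continuous_mul {a : ℍ → ℂ} (ha : Continuous a) (hf : NormallySummable f) :
    NormallySummable fun i z ↦ a z * f i z := by
  intro z
  obtain ⟨s, hs, u, hu, h⟩ := hf z
  have hb : ∀ᶠ w in 𝓝 z, ‖a w‖ < ‖a z‖ + 1 :=
    ha.norm.continuousAt.eventually_lt continuousAt_const (lt_add_one _)
  refine ⟨s ∩ {w | ‖a w‖ < ‖a z‖ + 1}, inter_mem hs hb, fun i ↦ (‖a z‖ + 1) * u i,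
    hu.mul_left _, fun i w hw ↦ ?_⟩
  rw [norm_mul]
  exact mul_le_mul hw.2.le (h i w hw.1) (norm_nonneg _) (by positivity)

/-- A normally summable family is dominated on some disc around each point. -/
lemma exists_ball (hf : NormallySummable f) (z : ℍ) :
    ∃ r > 0, Metric.ball (z : ℂ) r ⊆ upperHalfPlaneSet ∧ ∃ u : ι → ℝ, Summable u ∧
      ∀ i, ∀ w ∈ Metric.ball (z : ℂ) r, ‖(f i ∘ ofComplex) w‖ ≤ u i := by
  obtain ⟨s, hs, u, hu, h⟩ := hf z
  have h1 : ofComplex ⁻¹' s ∈ 𝓝 (z : ℂ) := by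
    apply (contMDiffAt_ofComplex (n := 1) z.im_pos).continuousAt
    rwa [ofComplex_apply]
  obtain ⟨r, hr, hsub⟩ := Metric.mem_nhds_iff.mp
    (inter_mem h1 (isOpen_upperHalfPlaneSet.mem_nhds z.im_pos))
  exact ⟨r, hr, fun w hw ↦ (hsub hw).2, u, hu, fun i w hw ↦ h i _ (hsub hw).1⟩

/-- Normal convergence passes to derivatives, by Cauchy's estimate on a smaller disc. -/
lemma deriv (hd : ∀ i, MDiff (f i)) (hf : NormallySummable f) :
    NormallySummable fun i ↦ D (f i) := by
  intro z
  obtain ⟨r, hr, hU, u, hu, h⟩ := hf.exists_ball z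
  refine ⟨(↑) ⁻¹' Metric.ball (z : ℂ) (r / 2),
    continuous_coe.continuousAt.preimage_mem_nhds (Metric.ball_mem_nhds _ (half_pos hr)),
    fun i ↦ ‖(2 * Real.pi * Complex.I : ℂ)⁻¹‖ * (u i / (r / 2)),
    (hu.div_const _).mul_left _, fun i w hw ↦ ?_⟩
  have hsub : Metric.closedBall (w : ℂ) (r / 2) ⊆ Metric.ball (z : ℂ) r := fun x hx ↦ by
    have := dist_triangle x (w : ℂ) z
    simp only [Set.mem_preimage, Metric.mem_ball, Metric.mem_closedBall] at *
    linarith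
  change ‖(2 * Real.pi * Complex.I : ℂ)⁻¹ * _root_.deriv (f i ∘ ofComplex) w‖ ≤ _
  rw [norm_mul]
  refine mul_le_mul_of_nonneg_left ?_ (norm_nonneg _)
  refine Complex.norm_deriv_le_of_forall_mem_sphere_norm_le (half_pos hr) ?_ fun x hx ↦
    h i x (hsub (Metric.sphere_subset_closedBall hx))
  refine DifferentiableOn.diffContOnCl ((UpperHalfPlane.mdifferentiable_iff.mp (hd i)).mono ?_)
  rw [closure_ball _ (half_pos hr).ne']
  exact hsub.trans hU

lemma mdifferentiable_tsum (hd : ∀ i, MDiff (f i)) (hf : NormallySummable f) :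
    MDiff fun z ↦ ∑' i, f i z := by
  intro z
  obtain ⟨r, hr, hU, u, hu, h⟩ := hf.exists_ball z
  rw [mdifferentiableAt_iff]
  exact (Complex.differentiableOn_tsum_of_summable_norm hu
    (fun i ↦ (UpperHalfPlane.mdifferentiable_iff.mp (hd i)).mono hU) Metric.isOpen_ball h).differentiableAt
      (Metric.ball_mem_nhds _ hr)

/-- A normally convergent series of holomorphic functions may be differentiated termwise. -/
lemma deriv_tsum (hd : ∀ i, MDiff (f i)) (hf : NormallySummable f) (z : ℍ) :
    D (fun z ↦ ∑' i, f i z) z = ∑' i, D (f i) z := by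
  obtain ⟨r, hr, hU, u, hu, h⟩ := hf.exists_ball z
  have := Complex.hasSum_deriv_of_summable_norm hu
    (fun i ↦ (UpperHalfPlane.mdifferentiable_iff.mp (hd i)).mono hU) Metric.isOpen_ball h
      (Metric.mem_ball_self hr)
  simp only [Derivative.normalizedDerivOfComplex, tsum_mul_left, this.tsum_eq]
  rfl

lemma serreDerivative (k : ℂ) (hd : ∀ i, MDiff (f i)) (hf : NormallySummable f) :
    NormallySummable fun i ↦ Derivative.serreDerivative k (f i) :=
  (hf.deriv hd).sub (hf.continuous_mul
    (continuous_const.mul E2_mdifferentiable.continuous))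

lemma serreDerivative_tsum (k : ℂ) (hd : ∀ i, MDiff (f i)) (hf : NormallySummable f) (z : ℍ) :
    Derivative.serreDerivative k (fun z ↦ ∑' i, f i z) z =
      ∑' i, Derivative.serreDerivative k (f i) z := by
  simp only [Derivative.serreDerivative_apply]
  rw [((hf.deriv hd).summable z).tsum_sub ((hf.summable z).mul_left _), tsum_mul_left,
    hf.deriv_tsum hd]

end NormallySummable

/-! ### The higher Serre derivatives -/

lemma serreDeriv_mdifferentiable (k : ℕ) {F : ℍ → ℂ} (hF : MDiff F) (n : ℕ) :
    MDiff (serreDeriv k n F) := by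
  induction n using Nat.twoStepInduction with
  | zero => exact hF
  | one => exact Derivative.serreDerivative_mdifferentiable _ hF
  | more n h0 h1 =>
    exact (Derivative.serreDerivative_mdifferentiable _ h1).sub
      ((mdifferentiable_const.mul ModularForm.E₄.holo').mul h0)

/-- The higher Serre derivatives of a normally convergent series of holomorphic functions are
computed termwise, and the resulting series is again normally convergent. -/
lemma NormallySummable.serreDeriv {ι : Type*} {f : ι → ℍ → ℂ} (k : ℕ) (hd : ∀ i, MDiff (f i))
    (hf : NormallySummable f) (n : ℕ) :
    NormallySummable (fun i ↦ serreDeriv k n (f i)) ∧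
      serreDeriv k n (fun z ↦ ∑' i, f i z) = fun z ↦ ∑' i, serreDeriv k n (f i) z := by
  induction n using Nat.twoStepInduction with
  | zero => exact ⟨hf, rfl⟩
  | one => exact ⟨hf.serreDerivative _ hd, funext (hf.serreDerivative_tsum _ hd)⟩
  | more n h0 h1 =>
    have hd1 i := serreDeriv_mdifferentiable k (hd i) (n + 1)
    have hE (c : ℂ) : Continuous fun z ↦ c * ModularForm.E₄ z :=
      continuous_const.mul ModularForm.E₄.holo'.continuous
    have hs := h1.1.serreDerivative ((k : ℂ) + 2 * (n + 1)) hd1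
    refine ⟨hs.sub (h0.1.continuous_mul (hE _)), funext fun z ↦ ?_⟩
    simp only [Poincare.serreDeriv]
    rw [h1.2, h0.2, h1.1.serreDerivative_tsum _ hd1,
      (hs.summable z).tsum_sub ((h0.1.summable z).mul_left _), tsum_mul_left]

/-- The higher Serre derivative in weight `k` intertwines the slash actions of weights `k` and
`k + 2n`: Mathlib has this for the first one, and `E₄` is modular of weight `4`. -/
lemma serreDeriv_slash (k : ℕ) {F : ℍ → ℂ} (hF : MDiff F) (γ : SL(2, ℤ)) (n : ℕ) :
    serreDeriv k n (F ∣[(k : ℤ)] γ) = serreDeriv k n F ∣[(k : ℤ) + 2 * (n : ℤ)] γ := by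
  induction n using Nat.twoStepInduction with
  | zero => simp [serreDeriv]
  | one => exact_mod_cast (Derivative.serreDerivative_slash_equivariant (k := (k : ℤ)) hF).symm
  | more n h0 h1 =>
    have hE : (ModularForm.E₄ : ℍ → ℂ) ∣[(4 : ℤ)] γ = ModularForm.E₄ :=
      SlashInvariantForm.slash_action_eqn ModularForm.E₄ _ ⟨γ, rfl⟩
    have hS := Derivative.serreDerivative_slash_equivariant (k := (k : ℤ) + 2 * ((n + 1 : ℕ) : ℤ))
      (serreDeriv_mdifferentiable k hF (n + 1)) (γ := γ)
    ext z
    have hEz := congrFun (ModularForm.mul_slash_SL2 4 ((k : ℤ) + 2 * (n : ℤ)) γ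
      ModularForm.E₄ (serreDeriv k n F)) z
    have hSz := congrFun hS z
    simp only [serreDeriv]
    rw [h0, h1]
    rw [show (k : ℤ) + 2 * ((n + 2 : ℕ) : ℤ) = k + 2 * ((n + 1 : ℕ) : ℤ) + 2 by push_cast; ring]
    rw [hE, show (4 : ℤ) + (k + 2 * n) = k + 2 * ((n + 1 : ℕ) : ℤ) + 2 by push_cast; ring] at hEz
    simp only [ModularForm.SL_slash_apply, Pi.mul_apply] at hEz hSz ⊢
    push_cast at hSz hEz ⊢
    rw [← hSz]
    linear_combination (((n : ℂ) + 1) * ((k : ℂ) + (n + 1) - 1) / 144) * hEz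

/-! ### Ramanujan's identity for `E₂` -/

/-- A function with a convergent `q`-expansion tends to its constant term at `i∞`: removing that
term and dividing by `q` leaves a bounded function. -/
lemma tendsto_atImInfty_of_hasSum_qExpansion {f : ℍ → ℂ} {c : ℕ → ℂ}
    (hf : ∀ τ : ℍ, HasSum (fun m ↦ c m • Function.Periodic.qParam 1 τ ^ m) (f τ)) :
    Tendsto f atImInfty (𝓝 (c 0)) := by
  have hq : Tendsto (fun τ : ℍ ↦ Function.Periodic.qParam 1 τ) atImInfty (𝓝 0) :=
    qParam_tendsto_atImInfty one_pos
  have hb : IsBoundedAtImInfty fun τ : ℍ ↦ (Function.Periodic.qParam 1 τ)⁻¹ * (f τ - c 0) := by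
    refine isBoundedAtImInfty_of_hasSum_qExpansion (c := fun m ↦ c (m + 1)) one_pos fun τ ↦ ?_
    have h := ((hasSum_nat_add_iff' 1).mpr (hf τ)).mul_left (Function.Periodic.qParam 1 τ)⁻¹
    have hq0 := Function.Periodic.qParam_ne_zero (h := 1) (τ : ℂ)
    simp only [Finset.sum_range_one, pow_zero, smul_eq_mul, mul_one] at h ⊢
    refine h.congr_fun fun m ↦ ?_
    field_simp
    ring
  have h0 : Tendsto (fun τ : ℍ ↦
      Function.Periodic.qParam 1 τ * ((Function.Periodic.qParam 1 τ)⁻¹ * (f τ - c 0)))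
      atImInfty (𝓝 0) :=
    hq.zero_mul_isBoundedUnder_le ((Asymptotics.isBigO_one_iff ℝ).mp hb)
  have h1 := h0.add_const (c 0)
  rw [zero_add] at h1
  refine h1.congr fun τ ↦ ?_
  rw [mul_inv_cancel_left₀ (Function.Periodic.qParam_ne_zero _), sub_add_cancel]

/-- If a holomorphic function has a limit at `i∞` then its derivative tends to `0` there, by
Cauchy's estimate on discs of radius `1`. -/
lemma isZeroAtImInfty_deriv {f : ℍ → ℂ} (hf : MDiff f) {c : ℂ}
    (h : Tendsto f atImInfty (𝓝 c)) : IsZeroAtImInfty (D f) := by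
  rw [isZeroAtImInfty_iff]
  intro ε hε
  have h' : IsZeroAtImInfty fun τ ↦ f τ - c := by
    simpa [IsZeroAtImInfty, ZeroAtFilter] using h.sub_const c
  obtain ⟨A, hA⟩ := isZeroAtImInfty_iff.mp h' ε hε
  refine ⟨max A 0 + 2, fun z hz ↦ ?_⟩
  have him : ∀ x ∈ Metric.closedBall (z : ℂ) 1, max A 0 < x.im := fun x hx ↦ by
    have h1 := Complex.abs_im_le_norm (x - z)
    rw [Complex.sub_im, coe_im] at h1
    have h2 := (abs_le.mp (h1.trans (mem_closedBall_iff_norm.mp hx))).1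
    linarith
  have hD : deriv (f ∘ ofComplex) z = deriv (fun w ↦ f (ofComplex w) - c) z := by
    rw [deriv_sub_const]; rfl
  have hbound : ‖deriv (f ∘ ofComplex) z‖ ≤ ε := by
    rw [hD, ← div_one ε]
    refine Complex.norm_deriv_le_of_forall_mem_sphere_norm_le one_pos ?_ fun x hx ↦ ?_
    · refine DifferentiableOn.diffContOnCl
        (((UpperHalfPlane.mdifferentiable_iff.mp hf).sub_const c).mono fun x hx ↦ ?_)
      rw [closure_ball _ one_ne_zero] at hx
      exact (le_max_right A 0).trans_lt (him x hx)
    · have hx' := him x (Metric.sphere_subset_closedBall hx)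
      refine hA _ ?_
      rw [ofComplex_apply_of_im_pos ((le_max_right A 0).trans_lt hx')]
      exact (le_max_left A 0).trans hx'.le
  have hpi : ‖(2 * Real.pi * Complex.I : ℂ)⁻¹‖ ≤ 1 := by
    simp only [norm_inv, norm_mul, Complex.norm_I, Complex.norm_real, Complex.norm_ofNat,
      Real.norm_eq_abs, abs_of_pos Real.pi_pos]
    exact inv_le_one_of_one_le₀ (by linarith [Real.pi_gt_three])
  rw [Derivative.normalizedDerivOfComplex, norm_mul]
  exact (mul_le_of_le_one_left (norm_nonneg _) hpi).trans hbound

/-- The anomaly of `E₂` cancels in `D E₂ - E₂² / 12`, which is modular of weight `4`. -/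
lemma deriv_E2_sub_slash (γ : SL(2, ℤ)) :
    (fun z ↦ D EisensteinSeries.E2 z - EisensteinSeries.E2 z ^ 2 / 12) ∣[(4 : ℤ)] γ =
      fun z ↦ D EisensteinSeries.E2 z - EisensteinSeries.E2 z ^ 2 / 12 := by
  have hE2 := E2_mdifferentiable
  ext z
  have hD := congrFun (Derivative.normalizedDerivOfComplex_SL_slash (k := 2) hE2 (γ := γ)) z
  have hpi : (Real.pi : ℂ) ≠ 0 := by exact_mod_cast Real.pi_ne_zero
  have hd : denom γ z ≠ 0 := denom_ne_zero γ z
  -- the anomaly `E₂ - E₂ ∣ γ` and its derivative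
  set A : ℍ → ℂ := fun w ↦ 6 * Complex.I / Real.pi * γ 1 0 * (denom γ w)⁻¹ with hA
  have hAmd : MDiff A := mdifferentiable_const.mul (mdifferentiable_inv_denom _)
  have hslash : EisensteinSeries.E2 ∣[(2 : ℤ)] γ = EisensteinSeries.E2 - A := by
    rw [EisensteinSeries.E2_slash_action]
    congr 1
    ext w
    simp only [hA, Pi.smul_apply, EisensteinSeries.D2, riemannZeta_two, smul_eq_mul]
    field_simp
  have hDA : D A z = A z ^ 2 / 12 := by
    have h1 : HasDerivAt (A ∘ ofComplex)
        (6 * Complex.I / Real.pi * γ 1 0 * (-(γ 1 0 : ℂ) * denom γ z ^ (-2 : ℤ))) z := by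
      have h2 := (hasDerivAt_denom_zpow (γ : GL (Fin 2) ℝ) (-1) z).const_mul
        (6 * Complex.I / Real.pi * γ 1 0 : ℂ)
      refine (h2.congr_deriv ?_).congr_of_eventuallyEq ?_
      · norm_num
      · filter_upwards [isOpen_upperHalfPlaneSet.mem_nhds z.im_pos] with w hw
        simp [hA, ofComplex_apply_of_im_pos hw]
    rw [Derivative.normalizedDerivOfComplex, h1.deriv]
    simp only [hA, zpow_neg]
    field_simp
    ring_nf
    simp
  rw [hslash, Derivative.normalizedDerivOfComplex_sub _ _ hE2 hAmd] at hD
  have hE := congrFun hslash z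
  simp only [ModularForm.SL_slash_apply, Pi.sub_apply] at hD hE ⊢
  rw [hDA] at hD
  have hc : ((2 : ℤ) : ℂ) * (2 * Real.pi * Complex.I)⁻¹ * (γ 1 0 / denom γ z) = -A z / 6 := by
    simp only [hA]
    field_simp
    simp
  have hsq : (denom γ z ^ (-2 : ℤ)) ^ 2 = denom γ z ^ (-4 : ℤ) := by
    rw [← zpow_natCast, ← zpow_mul]; norm_num
  rw [hc, show -((2 : ℤ) + 2) = -4 by norm_num] at hD
  linear_combination -hD - (EisensteinSeries.E2 (γ • z) * denom γ z ^ (-2 : ℤ) +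
    (EisensteinSeries.E2 z - A z)) / 12 * hE + EisensteinSeries.E2 (γ • z) ^ 2 / 12 * hsq

/-- Ramanujan's identity `D E₂ = (E₂² - E₄) / 12`: the difference of the two sides is a cusp form
of weight `4`, and there are none but `0`. -/
theorem deriv_E2 (z : ℍ) :
    D EisensteinSeries.E2 z = (EisensteinSeries.E2 z ^ 2 - ModularForm.E₄ z) / 12 := by
  have hE2 := E2_mdifferentiable
  set F : ℍ → ℂ := (fun z ↦ D EisensteinSeries.E2 z - EisensteinSeries.E2 z ^ 2 / 12) +
    (12⁻¹ : ℂ) • (ModularForm.E₄ : ℍ → ℂ) with hF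
  have hslash (γ : SL(2, ℤ)) : F ∣[(4 : ℤ)] γ = F := by
    rw [hF, SlashAction.add_slash, deriv_E2_sub_slash, ModularForm.SL_smul_slash]
    congr 2
    exact SlashInvariantForm.slash_action_eqn ModularForm.E₄ _ ⟨γ, rfl⟩
  have hmd : MDiff F := by
    refine ((Derivative.normalizedDerivOfComplex_mdifferentiable hE2).sub ?_).add
      (ModularForm.E₄.holo'.const_smul _)
    simp only [div_eq_mul_inv]
    exact (hE2.pow 2).mul mdifferentiable_const
  have hzero : IsZeroAtImInfty F := by
    have h2 : Tendsto EisensteinSeries.E2 atImInfty (𝓝 1) := by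
      have := tendsto_atImInfty_of_hasSum_qExpansion (f := EisensteinSeries.E2)
        (c := fun m ↦ if m = 0 then 1 else -24 * ArithmeticFunction.sigma 1 m) fun τ ↦ by
        simpa [Function.Periodic.qParam] using EisensteinSeries.hasSum_qExpansion_E2 (z := τ)
      simpa using this
    have h4 : Tendsto ModularForm.E₄ atImInfty (𝓝 1) := by
      have := tendsto_atImInfty_of_hasSum_qExpansion
        (ModularForm.hasSum_qExpansion ModularForm.E₄ one_pos one_mem_strictPeriods_SL)
      rwa [EisensteinSeries.E_qExpansion_coeff_zero _ ⟨2, rfl⟩] at this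
    have hd := isZeroAtImInfty_deriv hE2 h2
    have := (hd.sub ((h2.pow 2).div_const 12)).add (h4.const_smul (12⁻¹ : ℂ))
    rw [hF, IsZeroAtImInfty, ZeroAtFilter]
    convert this using 2
    · rfl
    · norm_num
  let f : CuspForm 𝒮ℒ 4 :=
    { toFun := F
      slash_action_eq' := fun _ ⟨γ, hγ⟩ ↦ hγ ▸ hslash γ
      holo' := hmd
      zero_at_cusps' := fun {c} hc ↦ by
        rw [Subgroup.IsArithmetic.isCusp_iff_isCusp_SL2Z] at hc
        rw [OnePoint.isZeroAt_iff_forall_SL2Z hc]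
        intro γ _
        rwa [hslash γ] }
  have hf : f = 0 :=
    rank_zero_iff_forall_zero.mp (CuspForm.rank_eq_zero_of_weight_lt_twelve (by norm_num)) f
  have h : F z = 0 := congrFun (congrArg DFunLike.coe hf) z
  simp only [hF, Pi.add_apply, Pi.smul_apply, smul_eq_mul] at h
  linear_combination h

/-! ### Convergence and modularity of the Poincaré series of `q^N` -/

/-- Two elements of `SL₂(ℤ)` with the same bottom row differ by a power of `T` on the left, so the
sum over cosets embeds into a sum over `ℤ²`. -/
lemma bottomRow_out_injective :
    Function.Injective fun M : Cosets ↦ (Quotient.out M : SL(2, ℤ)) 1 := by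
  intro M M' h
  have h' : (Quotient.out M : SL(2, ℤ)) 1 = (Quotient.out M' : SL(2, ℤ)) 1 := h
  rw [← Quotient.out_eq M, ← Quotient.out_eq M']
  refine Quotient.sound (QuotientGroup.rightRel_apply.mpr ?_)
  generalize (Quotient.out M : SL(2, ℤ)) = g at h' ⊢
  generalize (Quotient.out M' : SL(2, ℤ)) = g' at h' ⊢
  have h0 : g 1 0 = g' 1 0 := congrFun h' 0
  have h1 : g 1 1 = g' 1 1 := congrFun h' 1
  have hd := g.det_coe
  have hd' := g'.det_coe
  rw [Matrix.det_fin_two] at hd hd'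
  have key : g' * g⁻¹ = ModularGroup.T ^ (g' 0 1 * g 0 0 - g' 0 0 * g 0 1) := by
    rw [mul_inv_eq_iff_eq_mul]
    ext i j
    rw [Matrix.SpecialLinearGroup.coe_mul, ModularGroup.coe_T_zpow, Matrix.mul_apply,
      Fin.sum_univ_two]
    fin_cases i <;> fin_cases j <;> simp <;> grind
  rw [key]
  exact zpow_mem (Subgroup.subset_closure (Set.mem_insert _ _)) _

lemma norm_qPow_le_one (N : ℕ) (τ : ℍ) : ‖qPow N τ‖ ≤ 1 := by
  rw [qPow, norm_pow, Complex.norm_exp]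
  refine pow_le_one₀ (Real.exp_nonneg _) (Real.exp_le_one_iff.mpr ?_)
  simp only [Complex.mul_re, Complex.mul_im, Complex.I_re, Complex.I_im, Complex.ofReal_re,
    Complex.ofReal_im, Complex.re_ofNat, Complex.im_ofNat, coe_im, coe_re]
  have := mul_pos Real.pi_pos τ.im_pos
  ring_nf
  linarith

lemma qPow_vadd (N : ℕ) (τ : ℍ) : qPow N ((1 : ℝ) +ᵥ τ) = qPow N τ := by
  simp only [qPow, coe_vadd, Complex.ofReal_one]
  rw [mul_add, mul_one, Complex.exp_add, Complex.exp_two_pi_mul_I, one_mul]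

lemma hasDerivAt_qPow (N : ℕ) (τ : ℍ) :
    HasDerivAt (qPow N ∘ ofComplex) (2 * Real.pi * Complex.I * N * qPow N τ) τ := by
  have h1 : HasDerivAt (fun w : ℂ ↦ Complex.exp (N * (2 * Real.pi * Complex.I * w)))
      (Complex.exp (N * (2 * Real.pi * Complex.I * τ)) * (N * (2 * Real.pi * Complex.I * 1))) τ :=
    (((hasDerivAt_id (τ : ℂ)).const_mul _).const_mul _).cexp
  refine (h1.congr_deriv ?_).congr_of_eventuallyEq ?_
  · rw [qPow, ← Complex.exp_nat_mul]
    ring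
  · filter_upwards [isOpen_upperHalfPlaneSet.mem_nhds τ.im_pos] with w hw
    simp [qPow, ofComplex_apply_of_im_pos hw, ← Complex.exp_nat_mul]

lemma qPow_mdifferentiable (N : ℕ) : MDiff (qPow N) := fun τ ↦
  mdifferentiableAt_iff.mpr (hasDerivAt_qPow N τ).differentiableAt

lemma deriv_qPow (N : ℕ) (τ : ℍ) : D (qPow N) τ = N * qPow N τ := by
  rw [Derivative.normalizedDerivOfComplex, (hasDerivAt_qPow N τ).deriv]
  have := Complex.two_pi_I_ne_zero
  field_simp

/-- The terms of the Poincaré series of `q^N` are dominated on a vertical strip by those of an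
Eisenstein series, since `|q| < 1`. -/
lemma norm_cosetTerm_qPow_le {l : ℕ} (N : ℕ) {A B : ℝ} (hB : 0 < B) {z : ℍ}
    (hz : z ∈ verticalStrip A B) (M : Cosets) :
    ‖cosetTerm l (qPow N) M z‖ ≤ EisensteinSeries.r ⟨⟨A, B⟩, hB⟩ ^ (-(l : ℝ)) *
      ‖(Quotient.out M : SL(2, ℤ)) 1‖ ^ (-(l : ℝ)) := by
  rw [cosetTerm, ModularForm.SL_slash_apply, norm_mul]
  refine (mul_le_of_le_one_left (norm_nonneg _) (norm_qPow_le_one _ _)).trans ?_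
  refine le_trans (le_of_eq ?_) (EisensteinSeries.summand_bound_of_mem_verticalStrip
    (Nat.cast_nonneg l) ((Quotient.out M : SL(2, ℤ)) 1) hB hz)
  rw [ModularGroup.denom_apply, norm_zpow, ← Real.rpow_intCast]
  simp

lemma summable_norm_bottomRow {l : ℕ} (hl : 4 ≤ l) :
    Summable fun M : Cosets ↦ ‖(Quotient.out M : SL(2, ℤ)) 1‖ ^ (-(l : ℝ)) :=
  (EisensteinSeries.summable_one_div_norm_rpow
    (show (2 : ℝ) < l by exact_mod_cast (by omega : 2 < l))).comp_injective
      bottomRow_out_injective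

lemma cosetTerm_mdifferentiable (k : ℤ) {F : ℍ → ℂ} (hF : MDiff F) (M : Cosets) :
    MDiff (cosetTerm k F M) := by
  have : MDiff (F ∣[k] ((Quotient.out M : SL(2, ℤ)) : GL (Fin 2) ℝ)) := hF.slash k _
  exact this

/-- The cosets `Γ_∞ \ SL₂(ℤ)` are permuted by right multiplication. -/
def cosetsMulRight (γ : SL(2, ℤ)) : Cosets ≃ Cosets where
  toFun := Quotient.map (· * γ) fun a b h ↦ by
    change (QuotientGroup.rightRel GammaInf) _ _
    have h : (QuotientGroup.rightRel GammaInf) a b := h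
    rw [QuotientGroup.rightRel_apply] at h ⊢
    simpa [mul_assoc] using h
  invFun := Quotient.map (· * γ⁻¹) fun a b h ↦ by
    change (QuotientGroup.rightRel GammaInf) _ _
    have h : (QuotientGroup.rightRel GammaInf) a b := h
    rw [QuotientGroup.rightRel_apply] at h ⊢
    simpa [mul_assoc] using h
  left_inv M := by
    induction M using Quotient.inductionOn
    simp
  right_inv M := by
    induction M using Quotient.inductionOn
    simp

lemma cosetTerm_slash {k : ℤ} (hk : Even k) {F : ℍ → ℂ}
    (hF : ∀ τ : ℍ, F ((1 : ℝ) +ᵥ τ) = F τ) (M : Cosets) (γ : SL(2, ℤ)) :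
    cosetTerm k F M ∣[k] γ = cosetTerm k F (cosetsMulRight γ M) := by
  induction M using Quotient.inductionOn with
  | h g =>
    rw [cosetTerm_mk k hk F hF, ← SlashAction.slash_mul]
    exact (cosetTerm_mk k hk F hF (g * γ)).symm

lemma series_slash {k : ℤ} (hk : Even k) {F : ℍ → ℂ}
    (hF : ∀ τ : ℍ, F ((1 : ℝ) +ᵥ τ) = F τ) (γ : SL(2, ℤ)) :
    series k F ∣[k] γ = series k F := by
  ext z
  rw [ModularForm.SL_slash_apply, series, ← tsum_mul_right, series,
    ← (cosetsMulRight γ).tsum_eq fun M ↦ cosetTerm k F M z]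
  refine tsum_congr fun M ↦ ?_
  rw [← cosetTerm_slash hk hF, ModularForm.SL_slash_apply]

/-- By periodicity only the strip `|Re| ≤ 1`, `Im ≥ 1` matters, and there the dominating series does
not depend on the point. -/
lemma isBoundedAtImInfty_expSeries {l : ℕ} (hl : Even l) (hl4 : 4 ≤ l) (N : ℕ) :
    IsBoundedAtImInfty (expSeries l N) := by
  rw [isBoundedAtImInfty_iff]
  refine ⟨∑' M : Cosets, EisensteinSeries.r ⟨⟨1, 1⟩, one_pos⟩ ^ (-(l : ℝ)) *
    ‖(Quotient.out M : SL(2, ℤ)) 1‖ ^ (-(l : ℝ)), 1, fun z hz ↦ ?_⟩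
  -- a translate of `z` lies in the strip `|Re| ≤ 1`
  obtain ⟨n, hn⟩ := ModularGroup_T_zpow_mem_verticalStrip z one_pos
  have hinv : expSeries l N (ModularGroup.T ^ (((1 : ℕ) : ℤ) * n) • z) = expSeries l N z := by
    have h := congrFun (series_slash (k := l) (by exact_mod_cast hl) (qPow_vadd N)
      (ModularGroup.T ^ (((1 : ℕ) : ℤ) * n))) z
    rw [ModularForm.SL_slash_apply, ModularGroup.denom_apply, ModularGroup.coe_T_zpow] at h
    simpa [expSeries] using h
  rw [← hinv]
  refine tsum_of_norm_bounded ((summable_norm_bottomRow hl4).mul_left _).hasSum fun M ↦ ?_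
  exact norm_cosetTerm_qPow_le N one_pos
    (verticalStrip_anti_right _ hz (by simpa using hn)) M

/-! ### The seed as a polynomial in `E₂` -/

open Polynomial in
/-- The polynomial `p_n(X) = ∑_r C(n,r) (K+n)(K+n-1)⋯(K+n-r+1) N^{n-r} X^r`; with `K = l - 1`, the
seed of order `n` is `q^N p_n(-E₂/12)`. -/
def seedPoly (K N n : ℕ) : ℂ[X] :=
  ∑ r ∈ Finset.range (n + 1),
    monomial r ((n.choose r : ℂ) * (K + n).descFactorial r * (N : ℂ) ^ (n - r))

lemma seedPoly_coeff (K N n r : ℕ) :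
    (seedPoly K N n).coeff r = (n.choose r : ℂ) * (K + n).descFactorial r * (N : ℂ) ^ (n - r) := by
  rw [seedPoly, Polynomial.finsetSum_coeff]
  simp only [Polynomial.coeff_monomial, Finset.sum_ite_eq', Finset.mem_range]
  split_ifs with h
  · rfl
  · rw [Nat.choose_eq_zero_of_lt (by omega)]
    simp

open Polynomial in
lemma derivative_seedPoly (K N n : ℕ) :
    derivative (seedPoly K N (n + 1)) = C (((n : ℂ) + 1) * (K + n + 1)) * seedPoly K N n := by
  ext r
  rw [coeff_derivative, coeff_C_mul, seedPoly_coeff, seedPoly_coeff, ← add_assoc,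
    Nat.succ_descFactorial_succ, Nat.add_sub_add_right]
  have h : ((n : ℂ) + 1) * n.choose r = (n + 1).choose (r + 1) * (r + 1) := by
    exact_mod_cast Nat.add_one_mul_choose_eq n r
  push_cast
  linear_combination (-((K : ℂ) + n + 1) * (K + n).descFactorial r * (N : ℂ) ^ (n - r)) * h

open Polynomial in
lemma seedPoly_succ (K N n : ℕ) :
    seedPoly K N (n + 1) = (C (N : ℂ) + C ((K : ℂ) + 1 + 2 * n) * X) * seedPoly K N n -
      X * (X * derivative (seedPoly K N n)) := by
  ext r
  rw [add_mul, coeff_sub, coeff_add, mul_assoc, coeff_C_mul, coeff_C_mul]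
  rcases r with _ | r
  · simp [seedPoly_coeff, pow_succ']
  have hXd : (X * derivative (seedPoly K N n)).coeff r = r * (seedPoly K N n).coeff r := by
    rcases r with _ | r
    · simp
    · rw [coeff_X_mul, coeff_derivative]
      push_cast
      ring
  rw [coeff_X_mul, coeff_X_mul, hXd]
  simp only [seedPoly_coeff, Nat.add_sub_add_right]
  rcases lt_or_ge n r with h | h
  · rw [Nat.choose_eq_zero_of_lt h, Nat.choose_eq_zero_of_lt (by omega : n < r + 1),
      Nat.choose_eq_zero_of_lt (by omega : n + 1 < r + 1)]
    simp
  have hB : (n.choose (r + 1) : ℂ) * (r + 1) = n.choose r * (n - r) := by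
    have := Nat.choose_succ_right_eq n r
    rw [← Nat.cast_sub h]
    exact_mod_cast this
  have hpow : (n.choose (r + 1) : ℂ) * (N * (N : ℂ) ^ (n - (r + 1))) =
      n.choose (r + 1) * (N : ℂ) ^ (n - r) := by
    rcases h.eq_or_lt with rfl | h
    · simp
    · rw [← pow_succ', show n - (r + 1) + 1 = n - r by omega]
  rw [← add_assoc, Nat.succ_descFactorial_succ, Nat.descFactorial_succ, Nat.choose_succ_succ',
    Nat.cast_mul, Nat.cast_mul, Nat.cast_sub (by omega : r ≤ K + n)]
  push_cast
  linear_combination (-((K : ℂ) + n - r) * (K + n).descFactorial r) * hpow +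
    (((K + n).descFactorial r : ℂ) * (N : ℂ) ^ (n - r)) * hB

lemma seed_eq_eval (m N K : ℕ) (τ : ℍ) :
    seed m N (K + 1) τ =
      qPow N τ * (seedPoly K N m).eval (-EisensteinSeries.E2 τ / 12) := by
  rw [seed, seedPoly, Polynomial.eval_finsetSum]
  congr 1
  refine Finset.sum_congr rfl fun r hr ↦ ?_
  have hr' : r ≤ K + m := by have := Finset.mem_range.mp hr; omega
  have hfac : ((K + m - r)! : ℂ) ≠ 0 := by exact_mod_cast Nat.factorial_ne_zero _
  have h : (((K + m)! : ℕ) : ℂ) / ((K + m - r)! : ℂ) = (K + m).descFactorial r := by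
    rw [div_eq_iff hfac, mul_comm]
    exact_mod_cast (Nat.factorial_mul_descFactorial hr').symm
  rw [Polynomial.eval_monomial, show K + 1 + m - 1 = K + m by omega,
    show K + 1 + m - r - 1 = K + m - r by omega, h]
  ring

lemma deriv_polynomial_eval (p : Polynomial ℂ) {g : ℍ → ℂ} (hg : MDiff g) (τ : ℍ) :
    D (fun τ ↦ p.eval (g τ)) τ = p.derivative.eval (g τ) * D g τ := by
  have h1 : HasDerivAt (g ∘ ofComplex) (deriv (g ∘ ofComplex) τ) τ :=
    (mdifferentiableAt_iff.mp (hg τ)).hasDerivAt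
  have h2 := (p.hasDerivAt ((g ∘ ofComplex) (τ : ℂ))).comp (τ : ℂ) h1
  have h3 : deriv ((fun τ ↦ p.eval (g τ)) ∘ ofComplex) (τ : ℂ) =
      p.derivative.eval (g τ) * deriv (g ∘ ofComplex) τ := by
    refine h2.deriv.trans ?_
    rw [Function.comp_apply, ofComplex_apply]
  rw [Derivative.normalizedDerivOfComplex, h3, Derivative.normalizedDerivOfComplex]
  ring

lemma mdifferentiable_polynomial_eval (p : Polynomial ℂ) {g : ℍ → ℂ} (hg : MDiff g) :
    MDiff fun τ ↦ p.eval (g τ) := fun τ ↦ by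
  rw [mdifferentiableAt_iff]
  exact p.differentiable.differentiableAt.comp (τ : ℂ) (mdifferentiableAt_iff.mp (hg τ))

/-- With `X = -E₂/12`, Ramanujan's identity reads `D X = E₄/144 - X²`. -/
lemma deriv_qPow_mul_eval (N : ℕ) (p : Polynomial ℂ) (τ : ℍ) :
    D (fun τ ↦ qPow N τ * p.eval (-EisensteinSeries.E2 τ / 12)) τ =
      qPow N τ * (N * p.eval (-EisensteinSeries.E2 τ / 12) +
        p.derivative.eval (-EisensteinSeries.E2 τ / 12) *
          (ModularForm.E₄ τ / 144 - (-EisensteinSeries.E2 τ / 12) ^ 2)) := by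
  have hX : (fun τ ↦ -EisensteinSeries.E2 τ / 12) = (-12⁻¹ : ℂ) • EisensteinSeries.E2 := by
    ext
    simp only [Pi.smul_apply, smul_eq_mul]
    ring
  have hXd : MDiff fun τ ↦ -EisensteinSeries.E2 τ / 12 :=
    hX ▸ E2_mdifferentiable.const_smul _
  have hDX : D (fun τ ↦ -EisensteinSeries.E2 τ / 12) τ =
      ModularForm.E₄ τ / 144 - (-EisensteinSeries.E2 τ / 12) ^ 2 := by
    rw [hX, Derivative.normalizedDerivOfComplex_smul _ _ E2_mdifferentiable, Pi.smul_apply,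
      smul_eq_mul, deriv_E2]
    ring
  have h := congrFun (Derivative.normalizedDerivOfComplex_mul _ _ (qPow_mdifferentiable N)
    (mdifferentiable_polynomial_eval p hXd)) τ
  simp only [Pi.add_apply, Pi.mul_apply] at h
  refine h.trans ?_
  rw [deriv_qPow, deriv_polynomial_eval p hXd, hDX]
  ring

/-- In the recursion for `ϑ^{[n]} q^N` the terms with `E₄` cancel because of
`derivative_seedPoly`, and what remains is `seedPoly_succ`. -/
lemma serreDeriv_qPow_eq_eval (K N n : ℕ) :
    serreDeriv (K + 1) n (qPow N) =
      fun τ ↦ qPow N τ * (seedPoly K N n).eval (-EisensteinSeries.E2 τ / 12) := by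
  have hzero : seedPoly K N 0 = 1 := by simp [seedPoly]
  induction n using Nat.twoStepInduction with
  | zero =>
    ext τ
    simp [serreDeriv, hzero]
  | one =>
    ext τ
    rw [serreDeriv, Derivative.serreDerivative_apply, deriv_qPow, seedPoly_succ, hzero]
    simp
    ring
  | more n h0 h1 =>
    ext τ
    simp only [serreDeriv]
    rw [Derivative.serreDerivative_apply, h0, h1, deriv_qPow_mul_eval, seedPoly_succ _ _ (n + 1)]
    simp only [derivative_seedPoly, Polynomial.eval_sub, Polynomial.eval_add, Polynomial.eval_mul,
      Polynomial.eval_C, Polynomial.eval_X]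
    push_cast
    ring

/-! ### The Poincaré series and its Serre derivatives -/

lemma normallySummable_cosetTerm_qPow {l : ℕ} (hl4 : 4 ≤ l) (N : ℕ) :
    NormallySummable (cosetTerm l (qPow N)) := by
  intro z
  refine ⟨verticalStrip (|z.re| + 1) (z.im / 2), ?_, _,
    (summable_norm_bottomRow hl4).mul_left _, fun M w hw ↦
      norm_cosetTerm_qPow_le N (half_pos z.im_pos) hw M⟩
  have h1 : ∀ᶠ w : ℍ in 𝓝 z, |w.re| < |z.re| + 1 :=
    continuous_re.abs.continuousAt.eventually_lt continuousAt_const (lt_add_one _)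
  have h2 : ∀ᶠ w : ℍ in 𝓝 z, z.im / 2 < w.im :=
    continuousAt_const.eventually_lt continuous_im.continuousAt (half_lt_self z.im_pos)
  filter_upwards [h1, h2] with w hw1 hw2 using ⟨hw1.le, hw2.le⟩

lemma exists_modularForm_expSeries {l : ℕ} (hl : Even l) (hl4 : 4 ≤ l) (N : ℕ) :
    ∃ f : ModularForm 𝒮ℒ (l : ℤ), (f : ℍ → ℂ) = expSeries (l : ℤ) N := by
  have hslash := series_slash (k := l) (by exact_mod_cast hl) (qPow_vadd N)
  exact ⟨{
    toFun := expSeries l N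
    slash_action_eq' := fun _ ⟨γ, hγ⟩ ↦ hγ ▸ hslash γ
    holo' := (normallySummable_cosetTerm_qPow hl4 N).mdifferentiable_tsum
      (cosetTerm_mdifferentiable _ (qPow_mdifferentiable N))
    bdd_at_cusps' := fun {c} hc ↦ by
      rw [Subgroup.IsArithmetic.isCusp_iff_isCusp_SL2Z] at hc
      rw [OnePoint.isBoundedAt_iff_forall_SL2Z hc]
      intro γ _
      exact (hslash γ).symm ▸ isBoundedAtImInfty_expSeries hl hl4 N }, rfl⟩

lemma serreDeriv_qPow {l : ℕ} (hl : 0 < l) (m N : ℕ) :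
    serreDeriv l m (qPow N) = seed m N l := by
  obtain ⟨K, rfl⟩ := Nat.exists_eq_add_of_lt hl
  rw [zero_add, serreDeriv_qPow_eq_eval]
  exact funext fun τ ↦ (seed_eq_eval m N K τ).symm

lemma serreDeriv_cosetTerm_qPow {l : ℕ} (hl : 0 < l) (m N : ℕ) :
    (fun M ↦ serreDeriv l m (cosetTerm l (qPow N) M)) =
      cosetTerm ((l : ℤ) + 2 * (m : ℤ)) (seed m N l) := by
  ext1 M
  rw [cosetTerm, serreDeriv_slash l (qPow_mdifferentiable N), serreDeriv_qPow hl, cosetTerm]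

end Poincare

end

theorem theorem4 (m N l : ℕ) (hl : Even l) (hl4 : 4 ≤ l) (hlm : 2 * m + 2 ≤ l) :
    -- `P_{l,N}` is given by an absolutely convergent series and is a modular form of weight `l`
    Poincare.Converges (l : ℤ) (Poincare.qPow N) ∧
    (∃ f : ModularForm 𝒮ℒ (l : ℤ), (f : ℍ → ℂ) = Poincare.expSeries (l : ℤ) N) ∧
    -- the Poincaré series of `φ` converges absolutely, and it is the Serre derivative of `P_{l,N}`
    Poincare.Converges ((l : ℤ) + 2 * (m : ℤ)) (Poincare.seed m N l) ∧
    Poincare.serreDeriv l m (Poincare.expSeries (l : ℤ) N) =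
      Poincare.series ((l : ℤ) + 2 * (m : ℤ)) (Poincare.seed m N l) ∧
    -- `φ` is the result of the same operator on `q^N`
    Poincare.serreDeriv l m (Poincare.qPow N) = Poincare.seed m N l := by
  have hl0 : 0 < l := by omega
  have hs := Poincare.normallySummable_cosetTerm_qPow hl4 N
  obtain ⟨hconv, hsum⟩ := hs.serreDeriv l
    (Poincare.cosetTerm_mdifferentiable _ (Poincare.qPow_mdifferentiable N)) m
  have hterm := Poincare.serreDeriv_cosetTerm_qPow hl0 m N
  rw [hterm] at hconv
  refine ⟨hs.summable_norm, Poincare.exists_modularForm_expSeries hl hl4 N, hconv.summable_norm,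
    ?_, Poincare.serreDeriv_qPow hl0 m N⟩
  refine hsum.trans (funext fun z ↦ tsum_congr fun M ↦ ?_)
  exact congrFun (congrFun hterm M) z
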